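/- Let $T$ be a complete first-order theory in a language $L$ and let $\mathfrak{C}\models T$ be a monster model; it suffices that $\mathfrak{C}$ is $\kappa$-saturated for some infinite cardinal $\kappa$. Let $A\subseteq\mathfrak{C}$ with $|A|<\kappa$, and let $p(x)$ be a partial type over $A$ in a finite tuple of variables $x$. Formulas, types and indiscernibility below are in the language $L(A)$, which is $L$ with constants for the elements of $A$ (take $A=\emptyset$ for partial types without parameters); in particular indiscernible means indiscernible over $A$. All tuples are finite. For $C\subseteq\mathbb{R}$ and $i,j\in\mathbb{Q}$ write $i\sim_C j$ if for all $c\in C$ one has $c\le i\Leftrightarrow c\le j$ and $i\le c\Leftrightarrow j\le c$. For $n<\omega$, $p$ has dp-rank $\le n$ if for all $a\models p$ in $\mathfrak{C}$ and all indiscernible sequences $\langle b_i : i\in\mathbb{Q}\rangle$ of finite tuples of $\mathfrak{C}$ there is $C\subseteq\mathbb{R}$ with $|C|\le n$ such that $\mathrm{tp}(b_i/a)=\mathrm{tp}(b_j/a)$ whenever $i\sim_C j$. For a formula $\varphi(x;y)$ and a set $B$ of $|y|$-tuples of $\mathfrak{C}$, let $S_\varphi(B)\cap[p]$ be the set of all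 maximal subsets of $\{\varphi(x;b):b\in B\}\cup\{\neg\varphi(x;b):b\in B\}$ that are consistent with $p(x)$. For $\ell\in\mathbb{R}$, $\varphi$ has $\mathrm{VC}_{\mathrm{ind}}$-density $\le\ell$ with respect to $p$ if there is $K\in\mathbb{R}$ such that for all $N\ge 1$ and all indiscernible sequences $\langle b_i:i<N\rangle$ of $|y|$-tuples of $\mathfrak{C}$, with $B=\{b_i:i<N\}$, one has $|S_\varphi(B)\cap[p]|\le K\cdot N^\ell$. Then for every $n<\omega$: $p(x)$ has dp-rank $\le n$ if and only if every formula $\varphi(x;y)$ has $\mathrm{VC}_{\mathrm{ind}}$-density $\le n$ with respect to $p$. -/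

import Mathlib

open FirstOrder FirstOrder.Language
open scoped Cardinal

universe u v w

namespace VCInd

variable (L : FirstOrder.Language.{u, v})

/-- A set of formulas in the variables `α` is finitely satisfiable in `M`. -/
def FinitelySatisfiable {α : Type*} (M : Type w) [L.Structure M]
    (p : Set (L.Formula α)) : Prop :=
  ∀ s : Finset (L.Formula α), (s : Set (L.Formula α)) ⊆ p →
    ∃ a : α → M, ∀ ψ ∈ s, ψ.Realize a

/-- `M` is `κ`-saturated: every finitely satisfiable set of formulas in one free variable with
parameters from a set `A` of fewer than `κ` elements is realized in `M`. -/
def IsSaturated (M : Type w) [L.Structure M] (κ : Cardinal.{w}) : Prop :=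
  ∀ A : Set M, #A < κ → ∀ p : Set (L[[A]].Formula (Fin 1)),
    FinitelySatisfiable (L[[A]]) M p → ∃ c : Fin 1 → M, ∀ ψ ∈ p, ψ.Realize c

/-- The sequence of tuples `b` is indiscernible: any two strictly increasing finite subsequences
of the same length satisfy the same `L`-formulas. -/
def Indiscernible {M : Type w} [L.Structure M] {I : Type*} [LinearOrder I] {β : Type*} (b : I → β → M) : Prop :=
  ∀ (r : ℕ) (s t : Fin r → I), StrictMono s → StrictMono t →
    ∀ ψ : L.Formula (Fin r × β),
      ψ.Realize (fun z => b (s z.1) z.2) ↔ ψ.Realize (fun z => b (t z.1) z.2)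

/-- `tp(b/a)`, the complete type of `b` over `a`: the formula `ψ(a; y)` is represented by
the `L`-formula `ψ(x; y)`. -/
def tpOver {M : Type w} [L.Structure M] {α β : Type*} (a : α → M) (b : β → M) : Set (L.Formula (α ⊕ β)) :=
  {ψ | ψ.Realize (Sum.elim a b)}

/-- The relation `i ∼_C j` on the rationals, for a set `C` of reals. -/
def CutEquiv (C : Set ℝ) (i j : ℚ) : Prop :=
  ∀ c ∈ C, (c ≤ (i : ℝ) ↔ c ≤ (j : ℝ)) ∧ ((i : ℝ) ≤ c ↔ (j : ℝ) ≤ c)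

/-- The partial type `p(x)` has dp-rank at most `n` (computed in `M`). -/
def DPRankLE (M : Type w) [L.Structure M] {k : ℕ} (p : Set (L.Formula (Fin k))) (n : ℕ) : Prop :=
  ∀ a : Fin k → M, (∀ ψ ∈ p, ψ.Realize a) →
    ∀ (m : ℕ) (b : ℚ → Fin m → M), Indiscernible L b →
      ∃ C : Set ℝ, C.encard ≤ n ∧ ∀ i j : ℚ, CutEquiv C i j → tpOver L a (b i) = tpOver L a (b j)

/-- The formula `φ(x; b)` with parameters in `M`, obtained by substituting the tuple `b` for the
variables `y` of `φ(x; y)`. -/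
def formulaAt {M : Type w} {α β : Type*} (φ : L.Formula (α ⊕ β)) (b : β → M) : L[[M]].Formula α :=
  ((L.lhomWithConstants M).onFormula φ).subst
    (Sum.elim Term.var fun j => (L.con (b j)).term)

/-- `S_φ(B) ∩ [p]`: the maximal subsets of `{φ(x; b) : b ∈ B} ∪ {¬φ(x; b) : b ∈ B}` that are
consistent with `p(x)`. -/
def phiTypes {M : Type w} [L.Structure M] {α β : Type*}
    (p : Set (L.Formula α)) (φ : L.Formula (α ⊕ β)) (B : Set (β → M)) :
    Set (Set (L[[M]].Formula α)) :=
  {q | Maximal (fun q : Set (L[[M]].Formula α) =>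
      q ⊆ (fun b => formulaAt L φ b) '' B ∪ (fun b => (formulaAt L φ b).not) '' B ∧
      FinitelySatisfiable (L[[M]]) M ((L.lhomWithConstants M).onFormula '' p ∪ q)) q}

/-- `φ(x; y)` has VC_ind-density at most `ℓ` with respect to `p(x)` (computed in `M`); the finite
indiscernible sequences are nonempty. -/
def VCIndDensityLE (M : Type w) [L.Structure M] {k m : ℕ} (p : Set (L.Formula (Fin k)))
    (φ : L.Formula (Fin k ⊕ Fin m)) (ℓ : ℝ) : Prop :=
  ∃ K : ℝ, ∀ N : ℕ, 0 < N → ∀ b : Fin N → Fin m → M, Indiscernible L b →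
    (phiTypes L p φ (Set.range b)).Finite ∧
      ((phiTypes L p φ (Set.range b)).ncard : ℝ) ≤ K * (N : ℝ) ^ ℓ

end VCInd

namespace VCInd

/-! ### Saturation over finitely many parameters -/

section Saturation

variable {L : FirstOrder.Language.{u, v}} {M : Type w} [L.Structure M]

/-! Both conditions are measured by successive changes: pairs of indices `u 0 0 < u 0 1 < u 1 0 < ⋯`
(`IsPairSeq`) such that a realization `a` of `p` sees a difference inside every pair.

From rank to density: `n + 1` changes of `φ(a; b i)` on arbitrarily long finite indiscernible
sequences would by compactness (`exists_indiscernible_rat`) occur on one indexed by `ℚ`, and `n`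
cuts cannot separate `n + 1` disjoint pairs. So for large `N` no truth pattern has `n + 1` changes,
and there are only `O(N ^ n)` such words (`ncard_le_of_forall_not_isPairSeq`).

From density to rank: if the rank exceeds `n`, the type of `b i` over `a` changes near more than `n`
reals, which gives `n + 1` changing pairs, each witnessed by some `ψ t`. Let `φ(x; y₀y₁)` say that
some `ψ t` distinguishes `y₀` from `y₁`. Pairs can be placed in `ℚ` so that the changes occur
exactly at any prescribed `n + 1` of `N` positions (`exists_isPairSeq_ne_iff_mem`); indiscernibility
moves them all to one fixed sequence of pairs. Hence `φ` has at least `N.choose (n + 1)` patterns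
there, which exceeds `K * N ^ n` for a suitable `N`.

Saturation enters only through realizing types over finite tuples, which also identifies maximal
consistent `φ`-types with truth patterns. -/

variable (L M) in
/-- Finitely satisfiable sets of formulas in one variable over a finite tuple are realized. -/
def IsOmegaSaturated : Prop :=
  ∀ (β : Type) [Finite β] (c : β → M) (q : Set (L.Formula (β ⊕ Unit))),
    (∀ s : Finset (L.Formula (β ⊕ Unit)), (s : Set _) ⊆ q →
      ∃ x : M, ∀ ψ ∈ s, ψ.Realize (Sum.elim c fun _ => x)) →
    ∃ x : M, ∀ ψ ∈ q, ψ.Realize (Sum.elim c fun _ => x)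

theorem IsSaturated.isOmegaSaturated {κ : Cardinal.{w}} (hκ : ℵ₀ ≤ κ) (hM : IsSaturated L M κ)
    (A : Set M) (hA : #A < κ) : IsOmegaSaturated (L[[A]]) M := by
  classical
  intro β _ c q hq
  let A' : Set M := A ∪ Set.range c
  have hA' : #A' < κ :=
    (Cardinal.mk_union_le _ _).trans_lt
      (Cardinal.add_lt_of_lt hκ hA ((Cardinal.lt_aleph0_of_finite _).trans_le hκ))
  have hAA' : A ⊆ A' := Set.subset_union_left
  let f : L[[A]].Formula (β ⊕ Unit) → L[[A']].Formula (Fin 1) := fun ψ =>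
    ((L.lhomWithConstantsMap (Set.inclusion hAA')).onFormula ψ).subst
      (Sum.elim (fun i => (L.con (⟨c i, Or.inr ⟨i, rfl⟩⟩ : A')).term) fun _ => Term.var 0)
  have hf : ∀ (ψ : L[[A]].Formula (β ⊕ Unit)) (x : Fin 1 → M),
      (f ψ).Realize x ↔ ψ.Realize (Sum.elim c fun _ => x 0) := by
    intro ψ x
    refine BoundedFormula.realize_subst.trans ?_
    refine (LHom.realize_onFormula (L.lhomWithConstantsMap (Set.inclusion hAA')) ψ).trans ?_
    refine iff_of_eq (congrArg _ (funext ?_))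
    rintro (i | i)
    · simp
    · rfl
  obtain ⟨x, hx⟩ := hM A' hA' (f '' q) (by
    intro s hs
    obtain ⟨t, htq, rfl⟩ := Finset.subset_set_image_iff.1 hs
    obtain ⟨x, hx⟩ := hq t htq
    refine ⟨fun _ => x, fun ψ hψ => ?_⟩
    obtain ⟨θ, hθ, rfl⟩ := Finset.mem_image.1 hψ
    exact (hf _ _).2 (hx θ hθ))
  exact ⟨x 0, fun ψ hψ => (hf _ _).1 (hx _ ⟨ψ, hψ, rfl⟩)⟩

theorem realize_congr_of_freeVarFinset {V : Type*} [DecidableEq V] (χ : L.Formula V)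
    {v v' : V → M} (h : ∀ x ∈ χ.freeVarFinset, v x = v' x) : χ.Realize v ↔ χ.Realize v' := by
  have h1 := BoundedFormula.realize_restrictFreeVar (φ := χ) (f := id)
    (v := fun x => v x) (xs := (default : Fin 0 → M)) v (fun _ => rfl)
  have h2 := BoundedFormula.realize_restrictFreeVar (φ := χ) (f := id)
    (v := fun x => v x) (xs := (default : Fin 0 → M)) v' (fun x => h x x.2)
  exact h1.symm.trans h2

/-- The projection of a definable set of assignments to finitely many coordinates is definable. -/
theorem exists_formula_projection {V β : Type*} [Finite β] [Nonempty M] (χ : L.Formula V)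
    (h : β → V) : ∃ θ : L.Formula β, ∀ u : β → M,
      θ.Realize u ↔ ∃ v : V → M, v ∘ h = u ∧ χ.Realize v := by
  classical
  have := Fintype.ofFinite β
  let W : Finset V := χ.freeVarFinset ∪ Finset.univ.image h
  have hW : ∀ x : χ.freeVarFinset, (x : V) ∈ W := fun x => Finset.mem_union_left _ x.2
  have hhW : ∀ i, h i ∈ W := fun i =>
    Finset.mem_union_right _ (Finset.mem_image_of_mem _ (Finset.mem_univ i))
  let χ' : L.Formula (β ⊕ W) := χ.restrictFreeVar fun x => Sum.inr ⟨x, hW x⟩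
  let e : L.Formula (β ⊕ W) := Formula.iInf fun i : β =>
    Term.equal (Term.var (Sum.inr ⟨h i, hhW i⟩)) (Term.var (Sum.inl i))
  refine ⟨(χ' ⊓ e).iExs W, fun u => ?_⟩
  rw [Formula.realize_iExs]
  constructor
  · rintro ⟨x, hx⟩
    rw [Formula.realize_inf] at hx
    obtain ⟨hx1, hx2⟩ := hx
    let v : V → M := fun y => if hy : y ∈ W then x ⟨y, hy⟩ else Classical.arbitrary M
    refine ⟨v, ?_, ?_⟩
    · funext i
      rw [Formula.realize_iInf] at hx2
      have := hx2 i
      simp only [Formula.realize_equal, Term.realize_var, Sum.elim_inr, Sum.elim_inl] at this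
      simp [v, hhW i, this]
    · exact (BoundedFormula.realize_restrictFreeVar v fun y => by simp [v, hW y]).1 hx1
  · rintro ⟨v, rfl, hv⟩
    refine ⟨fun y => v y, ?_⟩
    rw [Formula.realize_inf]
    refine ⟨(BoundedFormula.realize_restrictFreeVar v fun y => by simp).2 hv, ?_⟩
    rw [Formula.realize_iInf]
    intro i
    simp [Formula.realize_equal]

variable {V : Type}

/-- Every finite subset of `S` is satisfied by an assignment that agrees with `c` on `F`. -/
def FinSatExtending (S : Set (L.Formula V)) (F : Finset V) (c : V → M) : Prop :=
  ∀ s : Finset (L.Formula V), (s : Set _) ⊆ S →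
    ∃ v : V → M, (∀ x ∈ F, v x = c x) ∧ ∀ ψ ∈ s, ψ.Realize v

theorem exists_iInf_realize {α : Type*} (s : Finset (L.Formula α)) :
    ∃ χ : L.Formula α, ∀ v : α → M, χ.Realize v ↔ ∀ ψ ∈ s, ψ.Realize v :=
  ⟨Formula.iInf fun ψ : s => ψ.1, fun v => by
    rw [Formula.realize_iInf]; exact Subtype.forall⟩

/-- The new value realizes, over the values on `F`, every consequence of a finite part of `S` in the
variables `F` and `x`. Projections of finite parts of `S` are among these consequences, so each
finite part stays satisfiable. -/
theorem IsOmegaSaturated.finSatExtending_insert [DecidableEq V] (hM : IsOmegaSaturated L M)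
    {S : Set (L.Formula V)} {F : Finset V} {c : V → M} (h : FinSatExtending S F c) (x : V) :
    ∃ c' : V → M, (∀ y ∈ F, c' y = c y) ∧ FinSatExtending S (insert x F) c' := by
  by_cases hxF : x ∈ F
  · exact ⟨c, fun _ _ => rfl, by rwa [Finset.insert_eq_of_mem hxF]⟩
  have : Nonempty M := ⟨c x⟩
  let g : F ⊕ Unit → V := Sum.elim (fun y => y) fun _ => x
  let q : Set (L.Formula (F ⊕ Unit)) := {θ | ∃ s : Finset (L.Formula V), (s : Set _) ⊆ S ∧
    ∀ v : V → M, (∀ ψ ∈ s, ψ.Realize v) → θ.Realize (v ∘ g)}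
  obtain ⟨e, he⟩ := hM F (fun y => c y) q (by
    intro t ht
    choose! s hsS hs using ht
    classical
    obtain ⟨v, hv, hvs⟩ := h (t.biUnion s) (by
      intro ψ hψ
      obtain ⟨θ, hθ, hψ⟩ := Finset.mem_biUnion.1 (Finset.mem_coe.1 hψ)
      exact hsS hθ hψ)
    refine ⟨v x, fun θ hθ => ?_⟩
    have := hs hθ v fun ψ hψ => hvs ψ (Finset.mem_biUnion.2 ⟨θ, hθ, hψ⟩)
    convert this using 1
    funext z
    rcases z with z | z
    · exact (hv z z.2).symm
    · rfl)
  refine ⟨Function.update c x e, fun y hy => ?_, fun s hs => ?_⟩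
  · exact Function.update_of_ne (ne_of_mem_of_not_mem hy hxF) _ _
  · obtain ⟨χ, hχ⟩ := exists_iInf_realize (M := M) s
    obtain ⟨θ, hθ⟩ := exists_formula_projection (M := M) χ g
    obtain ⟨v, hv, hvχ⟩ := (hθ _).1 (he θ ⟨s, hs, fun v hv => (hθ _).2 ⟨v, rfl, (hχ v).2 hv⟩⟩)
    refine ⟨v, fun y hy => ?_, (hχ v).1 hvχ⟩
    rcases Finset.mem_insert.1 hy with rfl | hy
    · simpa [g] using congrFun hv (Sum.inr ())
    · rw [Function.update_of_ne (ne_of_mem_of_not_mem hy hxF)]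
      exact congrFun hv (Sum.inl ⟨y, hy⟩)

/-- The variables are enumerated and fixed one at a time. The limit assignment works because each
formula sees only finitely many variables. -/
theorem IsOmegaSaturated.exists_realize_extending [Countable V] (hM : IsOmegaSaturated L M)
    {S : Set (L.Formula V)} {F : Finset V} {c : V → M} (h : FinSatExtending S F c) :
    ∃ v : V → M, (∀ x ∈ F, v x = c x) ∧ ∀ ψ ∈ S, ψ.Realize v := by
  classical
  rcases isEmpty_or_nonempty V with hV | hV
  · refine ⟨c, fun _ _ => rfl, fun ψ hψ => ?_⟩
    obtain ⟨v, -, hv⟩ := h {ψ} (by simpa using hψ)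
    rw [Subsingleton.elim c v]
    exact hv ψ (Finset.mem_singleton_self ψ)
  obtain ⟨x, hx⟩ := exists_surjective_nat V
  let G : ℕ → Finset V := fun n => F ∪ (Finset.range n).image x
  have hG : ∀ n, G (n + 1) = insert (x n) (G n) := fun n => by
    simp [G, Finset.range_add_one, Finset.image_insert]
  have hGm : Monotone G := fun i j hij =>
    Finset.union_subset_union_right (Finset.image_subset_image (Finset.range_mono hij))
  have step : ∀ (n : ℕ) (c : {c : V → M // FinSatExtending S (G n) c}),
      ∃ c' : {c : V → M // FinSatExtending S (G (n + 1)) c}, ∀ y ∈ G n, c'.1 y = c.1 y := by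
    rintro n ⟨c, hc⟩
    obtain ⟨c', hc', hS⟩ := hM.finSatExtending_insert hc (x n)
    exact ⟨⟨c', by rwa [hG]⟩, hc'⟩
  choose next hnext using step
  let C : ∀ n, {c : V → M // FinSatExtending S (G n) c} := fun n =>
    Nat.rec ⟨c, by simpa [G] using h⟩ (fun n c => next n c) n
  have hC : ∀ n, ∀ y ∈ G n, (C (n + 1)).1 y = (C n).1 y := fun n => hnext n (C n)
  have hC' : ∀ i j, i ≤ j → ∀ y ∈ G i, (C j).1 y = (C i).1 y := by
    intro i j hij
    induction j, hij using Nat.le_induction with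
    | base => exact fun _ _ => rfl
    | succ j hij ih => exact fun y hy => (hC j y (hGm hij hy)).trans (ih y hy)
  have hmem : ∀ y, ∃ n, y ∈ G n := fun y => by
    obtain ⟨n, rfl⟩ := hx y
    exact ⟨n + 1, by rw [hG]; exact Finset.mem_insert_self _ _⟩
  choose N hN using hmem
  have hlim : ∀ n, ∀ y ∈ G n, (C (N y)).1 y = (C n).1 y := by
    intro n y hy
    rcases le_total (N y) n with hle | hle
    · exact (hC' _ _ hle y (hN y)).symm
    · exact hC' _ _ hle y hy
  refine ⟨fun y => (C (N y)).1 y, fun y hy => hlim 0 y (by simpa [G] using hy), fun ψ hψ => ?_⟩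
  let m := ψ.freeVarFinset.sup N
  obtain ⟨v, hv, hvψ⟩ := (C m).2 {ψ} (by simpa using hψ)
  refine (realize_congr_of_freeVarFinset ψ fun y hy => ?_).1 (hvψ ψ (Finset.mem_singleton_self ψ))
  have hy' : y ∈ G m := hGm (Finset.le_sup hy) (hN y)
  exact (hv y hy').trans (hlim m y hy').symm

/-- Compactness in countably many variables over a finite tuple of parameters. -/
theorem IsOmegaSaturated.exists_realize {α β : Type} [Countable α] [Finite β]
    (hM : IsOmegaSaturated L M) (c : β → M) {ι : Type*} (χ : ι → L.Formula (α ⊕ β))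
    (h : ∀ s : Finset ι, ∃ a : α → M, ∀ i ∈ s, (χ i).Realize (Sum.elim a c)) :
    ∃ a : α → M, ∀ i, (χ i).Realize (Sum.elim a c) := by
  classical
  have := Fintype.ofFinite β
  obtain ⟨a₀, -⟩ := h ∅
  obtain ⟨v, hv, hS⟩ := hM.exists_realize_extending (S := Set.range χ)
    (F := Finset.univ.image Sum.inr) (c := Sum.elim a₀ c) (by
      intro s hs
      rw [← Set.image_univ] at hs
      obtain ⟨t, -, rfl⟩ := Finset.subset_set_image_iff.1 hs
      obtain ⟨a, ha⟩ := h t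
      refine ⟨Sum.elim a c, fun x hx => ?_, fun ψ hψ => ?_⟩
      · obtain ⟨y, -, rfl⟩ := Finset.mem_image.1 hx
        rfl
      · obtain ⟨i, hi, rfl⟩ := Finset.mem_image.1 hψ
        exact ha i hi)
  refine ⟨v ∘ Sum.inl, fun i => ?_⟩
  have hve : Sum.elim (v ∘ Sum.inl) c = v := by
    funext z
    rcases z with z | z
    · rfl
    · exact (hv (Sum.inr z) (Finset.mem_image_of_mem _ (Finset.mem_univ z))).symm
  rw [hve]
  exact hS _ ⟨i, rfl⟩

/-- An element seen along one increasing subsequence of an indiscernible sequence has a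
counterpart along every other one. -/
theorem Indiscernible.exists_realize_iff {I : Type*} [LinearOrder I] {α β : Type} [Finite α]
    [Finite β] (hM : IsOmegaSaturated L M) {b : I → β → M} (hb : Indiscernible L b) {r : ℕ}
    {s t : Fin r → I} (hs : StrictMono s) (ht : StrictMono t) (a : α → M) :
    ∃ a' : α → M, ∀ χ : L.Formula (α ⊕ (Fin r × β)),
      χ.Realize (Sum.elim a' fun z => b (t z.1) z.2) ↔
        χ.Realize (Sum.elim a fun z => b (s z.1) z.2) := by
  obtain ⟨a', ha'⟩ := hM.exists_realize (α := α) (fun z : Fin r × β => b (t z.1) z.2)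
    (fun χ : {χ : L.Formula (α ⊕ (Fin r × β)) //
      χ.Realize (Sum.elim a fun z => b (s z.1) z.2)} => χ.1) (by
    classical
    intro F
    obtain ⟨χ, hχ⟩ := exists_iInf_realize (M := M) (F.image Subtype.val)
    let θ : L.Formula (Fin r × β) := (χ.relabel Sum.swap).iExs α
    have hθ : ∀ y : Fin r × β → M, θ.Realize y ↔ ∃ x : α → M, χ.Realize (Sum.elim x y) := by
      intro y
      rw [Formula.realize_iExs]
      refine exists_congr fun x => ?_
      rw [Formula.realize_relabel]
      refine iff_of_eq (congrArg _ (funext ?_))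
      rintro (i | i) <;> rfl
    have h1 : θ.Realize fun z => b (s z.1) z.2 := (hθ _).2 ⟨a, (hχ _).2 (by
      intro ψ hψ
      obtain ⟨ψ, -, rfl⟩ := Finset.mem_image.1 hψ
      exact ψ.2)⟩
    obtain ⟨x, hx⟩ := (hθ _).1 ((hb r s t hs ht θ).1 h1)
    exact ⟨x, fun i hi => (hχ _).1 hx _ (Finset.mem_image_of_mem _ hi)⟩)
  refine ⟨a', fun χ => ⟨fun h => ?_, fun h => ha' ⟨χ, h⟩⟩⟩
  -- Realizing one direction for all formulas gives the converse by passing to negations.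
  by_contra hn
  exact (Formula.realize_not.1 (ha' ⟨χ.not, Formula.realize_not.2 hn⟩)) h

end Saturation

/-! ### Types over finite sequences and truth patterns -/

section Patterns

variable {L : FirstOrder.Language.{u, v}} {M : Type w} [L.Structure M]

theorem realize_formulaAt {α β : Type*} (φ : L.Formula (α ⊕ β)) (b : β → M) (a : α → M) :
    (formulaAt L φ b).Realize a ↔ φ.Realize (Sum.elim a b) := by
  refine BoundedFormula.realize_subst.trans ?_
  refine (LHom.realize_onFormula (L.lhomWithConstants M) φ).trans ?_
  refine iff_of_eq (congrArg _ (funext ?_))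
  rintro (i | i)
  · rfl
  · exact Term.realize_constants

/-- The truth patterns of `φ(a; b i)`, for `a` realizing `p`. -/
def patterns {α β I : Type*} (p : Set (L.Formula α)) (φ : L.Formula (α ⊕ β)) (b : I → β → M) :
    Set (I → Prop) :=
  {w | ∃ a : α → M, (∀ ψ ∈ p, ψ.Realize a) ∧ ∀ i, w i ↔ φ.Realize (Sum.elim a (b i))}

/-- The `φ`-type with truth pattern `w`. -/
def patternType {α β I : Type*} (φ : L.Formula (α ⊕ β)) (b : I → β → M) (w : I → Prop) :
    Set (L[[M]].Formula α) :=
  {ψ | ∃ i, (w i ∧ ψ = formulaAt L φ (b i)) ∨ (¬ w i ∧ ψ = (formulaAt L φ (b i)).not)}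

theorem mem_patternType_iff {α β I : Type*} {φ : L.Formula (α ⊕ β)} {b : I → β → M}
    {w : I → Prop} {a : α → M} (ha : ∀ i, w i ↔ φ.Realize (Sum.elim a (b i)))
    (ψ : L[[M]].Formula α) :
    ψ ∈ patternType φ b w ↔
      ψ ∈ (fun b => formulaAt L φ b) '' Set.range b ∪
        (fun b => (formulaAt L φ b).not) '' Set.range b ∧ ψ.Realize a := by
  constructor
  · rintro ⟨i, ⟨hi, rfl⟩ | ⟨hi, rfl⟩⟩
    · exact ⟨Or.inl ⟨_, ⟨i, rfl⟩, rfl⟩, (realize_formulaAt _ _ _).2 ((ha i).1 hi)⟩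
    · refine ⟨Or.inr ⟨_, ⟨i, rfl⟩, rfl⟩, ?_⟩
      rw [Formula.realize_not, realize_formulaAt]
      exact fun h => hi ((ha i).2 h)
  · rintro ⟨⟨_, ⟨i, rfl⟩, rfl⟩ | ⟨_, ⟨i, rfl⟩, rfl⟩, h⟩
    · exact ⟨i, Or.inl ⟨(ha i).2 ((realize_formulaAt _ _ _).1 h), rfl⟩⟩
    · refine ⟨i, Or.inr ⟨fun hi => ?_, rfl⟩⟩
      simp only [Formula.realize_not, realize_formulaAt] at h
      exact h ((ha i).1 hi)

/-- Realizability is essential: when `b` repeats a value, distinct arbitrary words can give the same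
set. -/
theorem injOn_patternType {α β I : Type*} (p : Set (L.Formula α)) (φ : L.Formula (α ⊕ β))
    (b : I → β → M) : Set.InjOn (patternType φ b) (patterns p φ b) := by
  have key : ∀ w ∈ patterns p φ b, ∀ w' ∈ patterns p φ b, patternType φ b w = patternType φ b w' →
      ∀ i, w i → w' i := by
    rintro w - w' ⟨a', -, ha'⟩ h i hi
    have : formulaAt L φ (b i) ∈ patternType φ b w' := h ▸ ⟨i, Or.inl ⟨hi, rfl⟩⟩
    exact (ha' i).2 ((realize_formulaAt _ _ _).1 ((mem_patternType_iff ha' _).1 this).2)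
  intro w hw w' hw' h
  funext i
  exact propext ⟨key w hw w' hw' h i, key w' hw' w hw h.symm i⟩

/-- Although `q` is written in `L[[M]]`, its parameters all lie in the finitely many finite tuples
`b i`. -/
theorem IsOmegaSaturated.exists_realize_union {α β I : Type} [Countable α] [Finite β] [Finite I]
    (hM : IsOmegaSaturated L M) {p : Set (L.Formula α)} {φ : L.Formula (α ⊕ β)} {b : I → β → M}
    {q : Set (L[[M]].Formula α)}
    (hq : q ⊆ (fun b => formulaAt L φ b) '' Set.range b ∪
        (fun b => (formulaAt L φ b).not) '' Set.range b)
    (hpq : FinitelySatisfiable (L[[M]]) M ((L.lhomWithConstants M).onFormula '' p ∪ q)) :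
    ∃ a : α → M, (∀ ψ ∈ p, ψ.Realize a) ∧ ∀ ψ ∈ q, ψ.Realize a := by
  classical
  have hφ : ∀ ψ : q, ∃ χ : L.Formula (α ⊕ (I × β)), ∀ a : α → M,
      χ.Realize (Sum.elim a fun z => b z.1 z.2) ↔ ψ.1.Realize a := by
    rintro ⟨ψ, hψ⟩
    have : ∀ (i : I) (a : α → M), Sum.elim a (fun z : I × β => b z.1 z.2) ∘
        Sum.map id (Prod.mk i) = Sum.elim a (b i) := by
      intro i a
      funext z
      rcases z with z | z <;> rfl
    rcases hq hψ with ⟨_, ⟨i, rfl⟩, rfl⟩ | ⟨_, ⟨i, rfl⟩, rfl⟩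
    · refine ⟨φ.relabel (Sum.map id (Prod.mk i)), fun a => ?_⟩
      rw [Formula.realize_relabel, this, realize_formulaAt]
    · refine ⟨(φ.relabel (Sum.map id (Prod.mk i))).not, fun a => ?_⟩
      simp only [Formula.realize_not, Formula.realize_relabel, this, realize_formulaAt]
  choose g hg using hφ
  have hp : ∀ (ψ : p) (a : α → M), (ψ.1.relabel Sum.inl : L.Formula (α ⊕ (I × β))).Realize
      (Sum.elim a fun z => b z.1 z.2) ↔ ψ.1.Realize a := fun ψ a => by
    rw [Formula.realize_relabel, Sum.elim_comp_inl]
  obtain ⟨a, ha⟩ := hM.exists_realize (α := α) (fun z : I × β => b z.1 z.2)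
    (Sum.elim (fun ψ : p => ψ.1.relabel Sum.inl) g) (by
      intro s
      obtain ⟨a, ha⟩ := hpq (s.image (Sum.elim
          (fun ψ : p => (L.lhomWithConstants M).onFormula ψ.1) fun ψ : q => ψ.1)) (by
        intro θ hθ
        obtain ⟨i, -, rfl⟩ := Finset.mem_image.1 (Finset.mem_coe.1 hθ)
        rcases i with ψ | ψ
        · exact Or.inl ⟨ψ.1, ψ.2, rfl⟩
        · exact Or.inr ψ.2)
      refine ⟨a, fun i hi => ?_⟩
      have := ha _ (Finset.mem_image_of_mem _ hi)
      rcases i with ψ | ψ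
      · exact (hp ψ a).2 ((LHom.realize_onFormula _ _).1 this)
      · exact (hg ψ a).2 this)
  exact ⟨a, fun ψ hψ => (hp ⟨ψ, hψ⟩ a).1 (ha (Sum.inl ⟨ψ, hψ⟩)),
    fun ψ hψ => (hg ⟨ψ, hψ⟩ a).1 (ha (Sum.inr ⟨ψ, hψ⟩))⟩

theorem FinitelySatisfiable.of_realize {α : Type*} {p : Set (L.Formula α)} {a : α → M}
    (h : ∀ ψ ∈ p, ψ.Realize a) : FinitelySatisfiable L M p :=
  fun _ hs => ⟨a, fun ψ hψ => h ψ (hs hψ)⟩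

/-- The maximal consistent `φ`-types over a finite sequence are those of the truth patterns. -/
theorem IsOmegaSaturated.phiTypes_eq_image {α β I : Type} [Countable α] [Finite β] [Finite I]
    (hM : IsOmegaSaturated L M) (p : Set (L.Formula α)) (φ : L.Formula (α ⊕ β))
    (b : I → β → M) :
    phiTypes L p φ (Set.range b) = patternType φ b '' patterns p φ b := by
  have cons : ∀ (w : I → Prop) (a : α → M), (∀ ψ ∈ p, ψ.Realize a) →
      (∀ i, w i ↔ φ.Realize (Sum.elim a (b i))) →
      FinitelySatisfiable (L[[M]]) M
        ((L.lhomWithConstants M).onFormula '' p ∪ patternType φ b w) := by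
    intro w a hap ha
    refine .of_realize (a := a) ?_
    rintro _ (⟨ψ, hψ, rfl⟩ | hψ)
    · exact (LHom.realize_onFormula _ _).2 (hap ψ hψ)
    · exact ((mem_patternType_iff ha _).1 hψ).2
  ext q
  constructor
  · rintro ⟨⟨hqs, hqc⟩, hmax⟩
    obtain ⟨a, hap, haq⟩ := hM.exists_realize_union hqs hqc
    let w : I → Prop := fun i => φ.Realize (Sum.elim a (b i))
    have ha : ∀ i, w i ↔ φ.Realize (Sum.elim a (b i)) := fun _ => Iff.rfl
    have hle : q ≤ patternType φ b w := fun ψ hψ =>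
      (mem_patternType_iff ha ψ).2 ⟨hqs hψ, haq ψ hψ⟩
    exact ⟨w, ⟨a, hap, ha⟩, (hmax
      ⟨fun ψ hψ => ((mem_patternType_iff ha ψ).1 hψ).1, cons w a hap ha⟩ hle).antisymm hle⟩
  · rintro ⟨w, ⟨a, hap, ha⟩, rfl⟩
    refine ⟨⟨fun ψ hψ => ((mem_patternType_iff ha ψ).1 hψ).1, cons w a hap ha⟩, ?_⟩
    rintro q ⟨hqs, hqc⟩ hle ψ hψ
    obtain ⟨a', -, haq⟩ := hM.exists_realize_union hqs hqc
    rcases hqs hψ with ⟨_, ⟨i, rfl⟩, rfl⟩ | ⟨_, ⟨i, rfl⟩, rfl⟩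
    · refine ⟨i, Or.inl ⟨by_contra fun hi => ?_, rfl⟩⟩
      exact Formula.realize_not.1 (haq _ (hle ⟨i, Or.inr ⟨hi, rfl⟩⟩)) (haq _ hψ)
    · refine ⟨i, Or.inr ⟨fun hi => ?_, rfl⟩⟩
      exact Formula.realize_not.1 (haq _ hψ) (haq _ (hle ⟨i, Or.inl ⟨hi, rfl⟩⟩))

theorem IsOmegaSaturated.finite_phiTypes {α β I : Type} [Countable α] [Finite β] [Finite I]
    (hM : IsOmegaSaturated L M) (p : Set (L.Formula α)) (φ : L.Formula (α ⊕ β))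
    (b : I → β → M) : (phiTypes L p φ (Set.range b)).Finite := by
  rw [hM.phiTypes_eq_image]
  exact (Set.toFinite _).image _

theorem IsOmegaSaturated.ncard_phiTypes {α β I : Type} [Countable α] [Finite β] [Finite I]
    (hM : IsOmegaSaturated L M) (p : Set (L.Formula α)) (φ : L.Formula (α ⊕ β))
    (b : I → β → M) :
    (phiTypes L p φ (Set.range b)).ncard = (patterns p φ b).ncard := by
  rw [hM.phiTypes_eq_image, (injOn_patternType p φ b).ncard_image]

end Patterns

/-! ### Increasing sequences of pairs -/

section Pairs

/-- The pairs `u 0 0 < u 0 1 < u 1 0 < u 1 1 < …` are in increasing order. -/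
def IsPairSeq {I : Type*} [LinearOrder I] {r : ℕ} (u : Fin r → Fin 2 → I) : Prop :=
  (∀ i, u i 0 < u i 1) ∧ ∀ i j, i < j → u i 1 < u j 0

/-- The elements of a sequence of pairs in a row. -/
def flatten {I : Type*} {r : ℕ} (u : Fin r → Fin 2 → I) (z : Fin (r * 2)) : I :=
  u (finProdFinEquiv.symm z).1 (finProdFinEquiv.symm z).2

@[simp]
theorem flatten_finProdFinEquiv {I : Type*} {r : ℕ} (u : Fin r → Fin 2 → I) (i : Fin r)
    (e : Fin 2) : flatten u (finProdFinEquiv (i, e)) = u i e := by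
  simp only [flatten, Equiv.symm_apply_apply]

theorem IsPairSeq.le {I : Type*} [LinearOrder I] {r : ℕ} {u : Fin r → Fin 2 → I}
    (hu : IsPairSeq u) (i : Fin r) (e : Fin 2) : u i 0 ≤ u i e ∧ u i e ≤ u i 1 := by
  fin_cases e
  · exact ⟨le_rfl, (hu.1 i).le⟩
  · exact ⟨(hu.1 i).le, le_rfl⟩

theorem IsPairSeq.strictMono_flatten {I : Type*} [LinearOrder I] {r : ℕ} {u : Fin r → Fin 2 → I}
    (hu : IsPairSeq u) : StrictMono (flatten u) := by
  intro x y hxy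
  obtain ⟨⟨i, e⟩, rfl⟩ := finProdFinEquiv.surjective x
  obtain ⟨⟨j, f⟩, rfl⟩ := finProdFinEquiv.surjective y
  rw [flatten_finProdFinEquiv, flatten_finProdFinEquiv]
  have hlt : (e : ℕ) + 2 * i < f + 2 * j := hxy
  rcases lt_trichotomy i j with hij | rfl | hij
  · exact (hu.le i e).2.trans_lt ((hu.2 i j hij).trans_le (hu.le j f).1)
  · have hef : (e : ℕ) < f := by omega
    obtain rfl : e = 0 := by ext; omega
    obtain rfl : f = 1 := by ext; simp at hef ⊢; omega
    exact hu.1 i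
  · have : (j : ℕ) < i := hij
    omega

/-- If a set of more than `n` reals is such that a colour-changing pair of rationals occurs close
to each of them, there are `n + 1` successive colour-changing pairs. -/
theorem exists_isPairSeq_of_lt_encard {X : Type*} (f : ℚ → X) (C : Set ℝ)
    (hC : ∀ c ∈ C, ∀ ε > 0, ∃ i j : ℚ, c - ε < i ∧ i < c + ε ∧ c - ε < j ∧ j < c + ε ∧ f i ≠ f j)
    (n : ℕ) (hn : (n : ℕ∞) < C.encard) :
    ∃ u : Fin (n + 1) → Fin 2 → ℚ, IsPairSeq u ∧ ∀ t, f (u t 0) ≠ f (u t 1) := by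
  obtain ⟨D, hDC, hD⟩ := Set.exists_subset_encard_eq (s := C) (k := (n + 1 : ℕ)) (by
    push_cast; exact Order.add_one_le_of_lt hn)
  have hDfin : D.Finite := Set.finite_of_encard_eq_coe hD
  have hcard : hDfin.toFinset.card = n + 1 := by
    rw [hDfin.encard_eq_coe_toFinset_card] at hD
    exact_mod_cast hD
  let x := hDfin.toFinset.orderEmbOfFin hcard
  have hx : ∀ t, x t ∈ C := fun t =>
    hDC (hDfin.mem_toFinset.1 (Finset.orderEmbOfFin_mem _ hcard t))
  -- A common radius making the neighbourhoods of the chosen reals disjoint, so that pairs found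
  -- inside them are successive.
  have hε : ∀ᶠ ε in nhdsWithin (0 : ℝ) (Set.Ioi 0), ∀ s t, s < t → x s + ε < x t - ε := by
    rw [Filter.eventually_all]; intro s
    rw [Filter.eventually_all]; intro t
    by_cases hst : s < t
    · have hlt : x s < x t := x.strictMono hst
      have : ∀ᶠ ε in nhdsWithin (0 : ℝ) (Set.Ioi 0), ε < (x t - x s) / 2 :=
        eventually_nhdsWithin_of_eventually_nhds (eventually_lt_nhds (by linarith))
      filter_upwards [this] with ε h _
      linarith
    · exact Filter.Eventually.of_forall fun _ h => absurd h hst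
  obtain ⟨ε, hε, hε0⟩ := (hε.and self_mem_nhdsWithin).exists
  have : ∀ t, ∃ v : Fin 2 → ℚ, x t - ε < v 0 ∧ v 0 < v 1 ∧ v 1 < x t + ε ∧ f (v 0) ≠ f (v 1) := by
    intro t
    obtain ⟨i, j, hi1, hi2, hj1, hj2, hij⟩ := hC (x t) (hx t) ε hε0
    rcases lt_trichotomy i j with h | rfl | h
    · exact ⟨![i, j], hi1, h, hj2, hij⟩
    · exact absurd rfl hij
    · exact ⟨![j, i], hj1, h, hi2, hij.symm⟩
  choose u h1 h2 h3 h4 using this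
  refine ⟨u, ⟨h2, fun s t hst => ?_⟩, h4⟩
  exact_mod_cast (h3 s).trans ((hε s t hst).trans (h1 t))

/-- A colouring of the rationals is constant on the classes cut out by the reals near which it is
not constant. -/
theorem eq_of_cutEquiv_of_locally_constant {X : Type*} (f : ℚ → X) (i j : ℚ)
    (h : CutEquiv {c : ℝ | ∀ ε > 0, ∃ i j : ℚ, c - ε < i ∧ i < c + ε ∧ c - ε < j ∧ j < c + ε ∧
      f i ≠ f j} i j) : f i = f j := by
  wlog hij : i ≤ j generalizing i j
  · exact (this j i (fun c hc => ⟨(h c hc).1.symm, (h c hc).2.symm⟩) (le_of_not_ge hij)).symm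
  rcases hij.eq_or_lt with rfl | hij
  · rfl
  have hloc : ∀ c ∈ Set.Icc (i : ℝ) j, ∃ ε > 0, ∀ i j : ℚ, c - ε < i → i < c + ε →
      c - ε < j → j < c + ε → f i = f j := by
    intro c hc
    by_contra! hcon
    have hcC := h c hcon
    have h1 : c ≤ i := hcC.1.2 hc.2
    have h2 : (j : ℝ) ≤ c := hcC.2.1 hc.1
    have : (i : ℝ) < j := by exact_mod_cast hij
    linarith
  choose! ε hε0 hε using hloc
  -- `P x y` says that `f` takes one common value near `x` and near `y`. It is symmetric, transitive
  -- and locally true, so connectedness of the interval spreads it from `i` to `j`.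
  let P : ℝ → ℝ → Prop := fun x y => ∃ δ > 0, ∀ i j : ℚ, x - δ < i → i < x + δ →
      y - δ < j → j < y + δ → f i = f j
  have hP : P i j := by
    refine isPreconnected_Icc.induction₂ (s := Set.Icc (i : ℝ) j) P (fun x hx => ?_) ?_ ?_
      (Set.left_mem_Icc.2 (by exact_mod_cast hij.le)) (Set.right_mem_Icc.2 (by exact_mod_cast hij.le))
    · have : ∀ᶠ y in nhdsWithin x (Set.Icc (i : ℝ) j), |y - x| < ε x / 2 :=
        eventually_nhdsWithin_of_eventually_nhds (eventually_abs_sub_lt x (half_pos (hε0 x hx)))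
      filter_upwards [this] with y hy
      rw [abs_lt] at hy
      refine ⟨ε x / 2, half_pos (hε0 x hx), fun i j h1 h2 h3 h4 => hε x hx i j ?_ ?_ ?_ ?_⟩ <;>
        linarith [hε0 x hx]
    · rintro x y z - - - ⟨δ, hδ, h1⟩ ⟨δ', hδ', h2⟩
      refine ⟨min δ δ', lt_min hδ hδ', fun i j hi1 hi2 hj1 hj2 => ?_⟩
      have hmin := lt_min hδ hδ'
      obtain ⟨k, hk1, hk2⟩ := exists_rat_btwn (show y - min δ δ' < y + min δ δ' by linarith)
      have := min_le_left δ δ'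
      have := min_le_right δ δ'
      exact (h1 i k (by linarith) (by linarith) (by linarith) (by linarith)).trans
        (h2 k j (by linarith) (by linarith) (by linarith) (by linarith))
    · rintro x y - - ⟨δ, hδ, h1⟩
      exact ⟨δ, hδ, fun i j hi1 hi2 hj1 hj2 => (h1 j i hj1 hj2 hi1 hi2).symm⟩
  obtain ⟨δ, hδ, hP⟩ := hP
  exact hP i j (by linarith) (by linarith) (by linarith) (by linarith)

/-- A set of at most `n` reals does not separate all members of `n + 1` successive pairs. -/
theorem IsPairSeq.exists_cutEquiv {n : ℕ} {u : Fin (n + 1) → Fin 2 → ℚ} (hu : IsPairSeq u)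
    {C : Set ℝ} (hC : C.encard ≤ n) : ∃ t, CutEquiv C (u t 0) (u t 1) := by
  by_contra! hcon
  -- A separating real lies in the closed interval of its pair; these intervals are disjoint, so `C`
  -- would have `n + 1` elements.
  have : ∀ t, ∃ c ∈ C, (u t 0 : ℝ) ≤ c ∧ c ≤ u t 1 := by
    intro t
    by_contra! hc
    refine hcon t fun c hcC => ?_
    have hlt : (u t 0 : ℝ) < u t 1 := by exact_mod_cast hu.1 t
    have := hc c hcC
    rcases lt_or_ge c (u t 0) with h | h
    · constructor <;> constructor <;> intro <;> linarith
    · have := this h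
      constructor <;> constructor <;> intro <;> linarith
  choose c hcC hc1 hc2 using this
  have hmono : StrictMono c := fun s t hst => by
    have : (u s 1 : ℝ) < u t 0 := by exact_mod_cast hu.2 s t hst
    linarith [hc2 s, hc1 t]
  have h1 : (Set.range c).encard ≤ C.encard :=
    Set.encard_le_encard (Set.range_subset_iff.2 hcC)
  rw [← Set.image_univ, hmono.injective.injOn.encard_image, Set.encard_univ] at h1
  have h2 := h1.trans hC
  simp only [ENat.card_eq_coe_fintype_card, Fintype.card_fin, Nat.cast_le] at h2
  omega

/-- If a finite colouring of the rationals changes on each of `n + 1` successive pairs, then every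
set of `n + 1` indices is the set where it changes along some sequence of `N` pairs. -/
theorem exists_isPairSeq_ne_iff_mem {X : Type*} [Finite X] (f : ℚ → X) {n : ℕ}
    {v : Fin (n + 1) → Fin 2 → ℚ} (hv : IsPairSeq v) (hne : ∀ t, f (v t 0) ≠ f (v t 1))
    {N : ℕ} (S : Finset (Fin N)) (hS : S.card = n + 1) :
    ∃ u : Fin N → Fin 2 → ℚ, IsPairSeq u ∧ ∀ i, f (u i 0) ≠ f (u i 1) ↔ i ∈ S := by
  classical
  -- monochromatic increasing sequences in the gaps between the pairs
  have hgap : ∀ t : ℕ, ∃ g : Fin (N * 2) → ℚ, StrictMono g ∧ (∀ x y, f (g x) = f (g y)) ∧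
      (∀ s : Fin (n + 1), (s : ℕ) < t → ∀ x, v s 1 < g x) ∧
      ∀ s : Fin (n + 1), t ≤ s → ∀ x, g x < v s 0 := by
    intro t
    let lo : Finset ℚ := (Finset.univ.filter fun s : Fin (n + 1) => (s : ℕ) < t).image fun s => v s 1
    let hi : Finset ℚ := (Finset.univ.filter fun s : Fin (n + 1) => t ≤ s).image fun s => v s 0
    obtain ⟨a, b, hab, ha, hb⟩ : ∃ a b : ℚ, a < b ∧ (∀ x ∈ lo, x ≤ a) ∧ ∀ x ∈ hi, b ≤ x := by
      obtain ⟨c, hc1, hc2⟩ := Order.exists_between_finsets lo hi (by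
        intro x hx y hy
        obtain ⟨s, hs, rfl⟩ := Finset.mem_image.1 hx
        obtain ⟨s', hs', rfl⟩ := Finset.mem_image.1 hy
        exact hv.2 s s' ((Finset.mem_filter.1 hs).2.trans_le (Finset.mem_filter.1 hs').2))
      obtain ⟨d, hd1, hd2⟩ := Order.exists_between_finsets {c} hi (by
        intro x hx y hy
        rw [Finset.mem_singleton.1 hx]
        exact hc2 y hy)
      exact ⟨c, d, hd1 c (Finset.mem_singleton_self c), fun x hx => (hc1 x hx).le,
        fun x hx => (hd2 x hx).le⟩
    have := (Set.Ioo_infinite hab).to_subtype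
    -- Pigeonhole: finitely many colours on an infinite interval. This is where finiteness of `X` is
    -- needed.
    obtain ⟨y, hy⟩ := Finite.exists_infinite_fiber fun z : Set.Ioo a b => f z
    obtain ⟨K, hK⟩ := Infinite.exists_subset_card_eq
      ((fun z : Set.Ioo a b => f z) ⁻¹' {y}) (N * 2)
    let g := K.orderEmbOfFin hK
    refine ⟨fun x => (g x).1.1, fun x x' h => g.strictMono h,
      fun x x' => (g x).2.trans (g x').2.symm, fun s hs x => ?_, fun s hs x => ?_⟩
    · exact (ha _ (Finset.mem_image_of_mem _ (Finset.mem_filter.2 ⟨Finset.mem_univ s, hs⟩))).trans_lt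
        (g x).1.2.1
    · exact (g x).1.2.2.trans_le
        (hb _ (Finset.mem_image_of_mem _ (Finset.mem_filter.2 ⟨Finset.mem_univ s, hs⟩)))
  choose g hg1 hg2 hg3 hg4 using hgap
  -- An index in `S` receives the changing pair numbered `pos i`; any other index receives its own
  -- two slots in the monochromatic sequence of gap `pos i`.
  let pos : Fin N → ℕ := fun i => (S.filter (· < i)).card
  have hposS : ∀ i ∈ S, pos i < n + 1 := fun i hi => hS ▸ Finset.card_lt_card
    (Finset.filter_ssubset.2 ⟨i, hi, lt_irrefl i⟩)
  have hmono : ∀ i j, i ≤ j → pos i ≤ pos j := fun i j hij =>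
    Finset.card_le_card fun x hx => by
      rw [Finset.mem_filter] at hx ⊢
      exact ⟨hx.1, hx.2.trans_le hij⟩
  have hlt : ∀ i j, i ∈ S → i < j → pos i < pos j := fun i j hi hij =>
    Finset.card_lt_card (Finset.ssubset_iff_of_subset (fun x hx => by
      rw [Finset.mem_filter] at hx ⊢
      exact ⟨hx.1, hx.2.trans hij⟩) |>.2 ⟨i, by simp [hi, hij], by simp⟩)
  refine ⟨fun i e => if hi : i ∈ S then v ⟨pos i, hposS i hi⟩ e
    else g (pos i) (finProdFinEquiv (i, e)), ⟨fun i => ?_, fun i j hij => ?_⟩, fun i => ?_⟩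
  · by_cases hi : i ∈ S
    · simp only [hi, dif_pos]
      exact hv.1 _
    · simp only [hi, not_false_eq_true, dif_neg]
      refine hg1 _ ?_
      simp [finProdFinEquiv, Fin.lt_def]
  · by_cases hi : i ∈ S <;> by_cases hj : j ∈ S <;>
      simp only [hi, hj, dif_pos, not_false_eq_true, dif_neg]
    · exact hv.2 _ _ (hlt i j hi hij)
    · exact hg3 _ _ (hlt i j hi hij) _
    · exact hg4 _ _ (hmono i j hij.le) _
    · rcases (hmono i j hij.le).eq_or_lt with h | h
      · rw [h]
        refine hg1 _ ?_
        have : (i : ℕ) < j := hij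
        simp [finProdFinEquiv, Fin.lt_def]
        omega
      · have hn : pos i < n + 1 := h.trans_le (hS ▸ Finset.card_filter_le _ _)
        exact (hg4 _ ⟨pos i, hn⟩ le_rfl _).trans ((hv.1 _).trans (hg3 _ ⟨pos i, hn⟩ h _))
  · by_cases hi : i ∈ S
    · simp only [hi, dif_pos, iff_true]
      exact hne _
    · simp only [hi, not_false_eq_true, dif_neg, iff_false, not_not]
      exact hg2 _ _ _

end Pairs

/-! ### Counting truth patterns with few changes -/

section Counting

/-- The words that are constant between `n` marked places, and take at each marked place the
negation of the preceding value. -/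
def simpleWords (N : ℕ) : ℕ → Set (ℕ → Prop)
  | 0 => Set.range fun (v : Prop) (_ : ℕ) => v
  | n + 1 => (fun (z : (Fin (N + 1) × Prop) × (ℕ → Prop)) (i : ℕ) =>
      if i < (z.1.1 : ℕ) then z.1.2 else if i = z.1.1 then ¬ z.1.2 else z.2 i) ''
        (Set.univ ×ˢ simpleWords N n)

theorem finite_simpleWords (N n : ℕ) : (simpleWords N n).Finite := by
  induction n with
  | zero => exact Set.finite_range _
  | succ n ih => exact (Set.finite_univ.prod ih).image _

theorem ncard_simpleWords_le (N n : ℕ) :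
    (simpleWords N n).ncard ≤ 2 ^ (n + 1) * (N + 1) ^ n := by
  induction n with
  | zero =>
    rw [simpleWords, ← Set.image_univ]
    refine (Set.ncard_image_le Set.finite_univ).trans ?_
    simp [Set.ncard_univ]
  | succ n ih =>
    refine (Set.ncard_image_le (Set.finite_univ.prod (finite_simpleWords N n))).trans ?_
    rw [Set.ncard_prod, Set.ncard_univ, Nat.card_eq_fintype_card]
    simp only [Fintype.card_prod, Fintype.card_fin, Fintype.card_prop]
    calc (N + 1) * 2 * (simpleWords N n).ncard
        ≤ (N + 1) * 2 * (2 ^ (n + 1) * (N + 1) ^ n) := Nat.mul_le_mul_left _ ih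
      _ = 2 ^ (n + 1 + 1) * (N + 1) ^ (n + 1) := by ring

/-- Greedy search: pair `s` with the first `j` where the value differs from that at `s`, then
restart at `j + 1`, as pairs must be disjoint. Each success uses one marked place, and the value
after it is free. -/
theorem exists_isPairSeq_or_simpleWords (w : ℕ → Prop) (N n s : ℕ) :
    (∃ u : Fin (n + 1) → Fin 2 → ℕ, IsPairSeq u ∧ (∀ t e, s ≤ u t e ∧ u t e < N) ∧
      ∀ t, ¬ (w (u t 0) ↔ w (u t 1))) ∨
    ∃ f ∈ simpleWords N n, ∀ i, s ≤ i → i < N → (w i ↔ f i) := by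
  classical
  induction n generalizing s with
  | zero =>
    by_cases h : ∃ j, s ≤ j ∧ j < N ∧ ¬ (w s ↔ w j)
    · obtain ⟨j, hsj, hjN, hj⟩ := h
      have hlt : s < j := hsj.lt_of_ne (by rintro rfl; exact hj Iff.rfl)
      refine Or.inl ⟨fun _ => ![s, j], ⟨fun _ => hlt, fun i j hij => ?_⟩, fun _ e => ?_, fun _ => hj⟩
      · omega
      · fin_cases e
        · exact ⟨le_rfl, hlt.trans hjN⟩
        · exact ⟨hsj, hjN⟩
    · push Not at h
      exact Or.inr ⟨fun _ => w s, ⟨w s, rfl⟩, fun i hi hiN => (h i hi hiN).symm⟩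
  | succ n ih =>
    by_cases h : ∃ j, s ≤ j ∧ j < N ∧ ¬ (w s ↔ w j)
    · obtain ⟨hsj, hjN, hj⟩ := Nat.find_spec h
      have hmin : ∀ i, s ≤ i → i < Nat.find h → (w s ↔ w i) := fun i hi hij => by
        by_contra hcon
        exact Nat.find_min h hij ⟨hi, hij.trans hjN, hcon⟩
      set j := Nat.find h
      have hlt : s < j := hsj.lt_of_ne fun hsj => hj (hsj ▸ Iff.rfl)
      rcases ih (j + 1) with ⟨u, hu, huN, huw⟩ | ⟨f, hf, hfw⟩
      · refine Or.inl ⟨Fin.cons ![s, j] u, ⟨fun i => ?_, fun i i' hii' => ?_⟩, fun i e => ?_,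
          fun i => ?_⟩
        · refine Fin.cases ?_ (fun i => ?_) i
          · exact hlt
          · exact hu.1 i
        · obtain ⟨i', rfl⟩ := Fin.exists_succ_eq.2 (Fin.ne_zero_of_lt hii')
          refine Fin.cases (fun _ => ?_) (fun i hii' => ?_) i hii'
          · exact (huN i' 0).1
          · exact hu.2 i i' (Fin.succ_lt_succ_iff.1 hii')
        · refine Fin.cases ?_ (fun i => ?_) i
          · fin_cases e
            · exact ⟨le_rfl, hlt.trans hjN⟩
            · exact ⟨hsj, hjN⟩
          · exact ⟨hsj.trans ((Nat.le_succ j).trans (huN i e).1), (huN i e).2⟩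
        · refine Fin.cases ?_ (fun i => ?_) i
          · exact hj
          · exact huw i
      · refine Or.inr ⟨_, ⟨((⟨j, by omega⟩, w s), f), ⟨Set.mem_univ _, hf⟩, rfl⟩,
          fun i hi hiN => ?_⟩
        simp only
        split_ifs with h1 h2
        · exact (hmin i hi h1).symm
        · rw [h2]; tauto
        · exact hfw i (by omega) hiN
    · push Not at h
      obtain ⟨f, hf⟩ : (simpleWords N n).Nonempty := by
        clear ih h
        induction n with
        | zero => exact ⟨_, True, rfl⟩
        | succ n ih => exact ih.elim fun f hf => ⟨_, ((0, True), f), ⟨Set.mem_univ _, hf⟩, rfl⟩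
      -- Marking the place `N` itself means that no change occurs below `N`; the remainder `f` is
      -- irrelevant.
      refine Or.inr ⟨_, ⟨((Fin.last N, w s), f), ⟨Set.mem_univ _, hf⟩, rfl⟩, fun i hi hiN => ?_⟩
      simp only [Fin.val_last, hiN, if_true]
      exact (h i hi hiN).symm

/-- A set of words of length `N` without `n + 1` successive changes has size `O(N ^ n)`. -/
theorem ncard_le_of_forall_not_isPairSeq {N n : ℕ} (hN : 0 < N) (W : Set (Fin N → Prop))
    (hW : ∀ w ∈ W, ∀ u : Fin (n + 1) → Fin 2 → Fin N, IsPairSeq u →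
      ∃ t, w (u t 0) ↔ w (u t 1)) :
    W.ncard ≤ 2 ^ (2 * n + 1) * N ^ n := by
  have hsub : W ⊆ (fun (f : ℕ → Prop) (i : Fin N) => f i) '' simpleWords N n := by
    intro w hw
    rcases exists_isPairSeq_or_simpleWords (fun i => ∃ h : i < N, w ⟨i, h⟩) N n 0 with
      ⟨u, hu, huN, huw⟩ | ⟨f, hf, hfw⟩
    · obtain ⟨t, ht⟩ := hW w hw (fun t e => ⟨u t e, (huN t e).2⟩)
        ⟨fun i => hu.1 i, fun i j hij => hu.2 i j hij⟩
      exact absurd (by simpa [(huN t _).2] using ht) (huw t)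
    · refine ⟨f, hf, funext fun i => propext ?_⟩
      simpa using (hfw i (Nat.zero_le _) i.2).symm
  calc W.ncard ≤ (simpleWords N n).ncard :=
        (Set.ncard_le_ncard hsub ((finite_simpleWords N n).image _)).trans
          (Set.ncard_image_le (finite_simpleWords N n))
    _ ≤ 2 ^ (n + 1) * (N + 1) ^ n := ncard_simpleWords_le N n
    _ ≤ 2 ^ (n + 1) * (2 * N) ^ n :=
        Nat.mul_le_mul_left _ (Nat.pow_le_pow_left (by omega) n)
    _ = 2 ^ (2 * n + 1) * N ^ n := by rw [mul_pow]; ring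

theorem exists_lt_choose (n : ℕ) (K : ℝ) :
    ∃ N : ℕ, 0 < N ∧ K * (N : ℝ) ^ n < N.choose (n + 1) := by
  obtain ⟨q, hq⟩ := exists_nat_gt (|K| * (n + 1 : ℝ) ^ n * (n + 1).factorial)
  have hq0 : (0 : ℝ) < q := lt_of_le_of_lt (by positivity) hq
  have hq1 : 1 ≤ q := by exact_mod_cast hq0
  -- With `N = q * (n + 1)` one has `N - n ≥ q`, so the binomial is at least `q ^ (n + 1) / (n +
  -- 1)!`, while `N ^ n` is only `(n + 1) ^ n * q ^ n`.
  refine ⟨q * (n + 1), by positivity, ?_⟩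
  have h1 := Nat.pow_le_choose (α := ℝ) (n + 1) (q * (n + 1))
  have h2 : q ≤ q * (n + 1) + 1 - (n + 1) := by
    have : n ≤ q * n := Nat.le_mul_of_pos_left n hq1
    rw [mul_add]
    omega
  refine lt_of_lt_of_le ?_ h1
  rw [lt_div_iff₀ (by positivity)]
  have h3 : (q : ℝ) ^ (n + 1) ≤ ((q * (n + 1) + 1 - (n + 1) : ℕ) : ℝ) ^ (n + 1) :=
    pow_le_pow_left₀ hq0.le (by exact_mod_cast h2) _
  refine lt_of_lt_of_le ?_ h3
  push_cast
  calc K * (q * (n + 1) : ℝ) ^ n * (n + 1).factorial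
      ≤ |K| * (q * (n + 1) : ℝ) ^ n * (n + 1).factorial := by gcongr; exact le_abs_self K
    _ = (|K| * (n + 1 : ℝ) ^ n * (n + 1).factorial) * q ^ n := by rw [mul_pow]; ring
    _ < q * q ^ n := by gcongr
    _ = q ^ (n + 1) := by ring

end Counting

/-! ### Dp-rank and the density of truth patterns -/

section Main

variable {L : FirstOrder.Language.{u, v}} {M : Type w} [L.Structure M]

/-- If arbitrarily long finite indiscernible sequences carry `r` successive changes of
`φ(a; b i)`, for `a` realizing `p`, then so does one indexed by the rationals. -/
theorem IsOmegaSaturated.exists_indiscernible_rat {k m r : ℕ} (hM : IsOmegaSaturated L M)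
    (p : Set (L.Formula (Fin k))) (φ : L.Formula (Fin k ⊕ Fin m))
    (h : ∀ N₀ : ℕ, ∃ N ≥ N₀, ∃ b : Fin N → Fin m → M, Indiscernible L b ∧
      ∃ a : Fin k → M, (∀ ψ ∈ p, ψ.Realize a) ∧ ∃ u : Fin r → Fin 2 → Fin N, IsPairSeq u ∧
        ∀ t, ¬ (φ.Realize (Sum.elim a (b (u t 0))) ↔ φ.Realize (Sum.elim a (b (u t 1))))) :
    ∃ b : ℚ → Fin m → M, Indiscernible L b ∧
      ∃ a : Fin k → M, (∀ ψ ∈ p, ψ.Realize a) ∧ ∃ u : Fin r → Fin 2 → ℚ, IsPairSeq u ∧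
        ∀ t, ¬ (φ.Realize (Sum.elim a (b (u t 0))) ↔ φ.Realize (Sum.elim a (b (u t 1)))) := by
  classical
  let u : Fin r → Fin 2 → ℚ := fun t e => ((finProdFinEquiv (t, e) : ℕ) : ℚ)
  have hu : IsPairSeq u := by
    refine ⟨fun i => ?_, fun i j hij => ?_⟩
    · simp [u, finProdFinEquiv]
    · have : (i : ℕ) < j := hij
      simp only [u, finProdFinEquiv, Nat.cast_lt]
      simp
      omega
  let V := Fin k ⊕ (ℚ × Fin m)
  -- The conditions to be realized: `p(x)`, the changes along `u`, and indiscernibility.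
  let ι := p ⊕ Fin r ⊕ (Σ j : ℕ, {z : (Fin j → ℚ) × (Fin j → ℚ) // StrictMono z.1 ∧ StrictMono z.2} ×
    L.Formula (Fin j × Fin m))
  let at' : ℚ → L.Formula V := fun x => φ.relabel (Sum.map id (Prod.mk x))
  let χ : ι → L.Formula V := Sum.elim (fun ψ => ψ.1.relabel Sum.inl) (Sum.elim
    (fun t => ((at' (u t 0)).iff (at' (u t 1))).not)
    fun z => (z.2.2.relabel fun y => Sum.inr (z.2.1.1.1 y.1, y.2)).iff
      (z.2.2.relabel fun y => Sum.inr (z.2.1.1.2 y.1, y.2)))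
  have hat : ∀ x (v : V → M), (at' x).Realize v ↔
      φ.Realize (Sum.elim (v ∘ Sum.inl) fun y => v (Sum.inr (x, y))) := by
    intro x v
    rw [Formula.realize_relabel]
    refine iff_of_eq (congrArg _ (funext ?_))
    rintro (i | i) <;> rfl
  obtain ⟨v, hv⟩ : ∃ v : V → M, ∀ i, (χ i).Realize v := by
    obtain ⟨v, hv⟩ := hM.exists_realize (α := V) (β := Empty) Empty.elim
      (fun i => (χ i).relabel Sum.inl) (by
        intro s
        simp only [Formula.realize_relabel, Sum.elim_comp_inl]
        let Q : Finset ℚ := (Finset.univ.image fun z : Fin r × Fin 2 => u z.1 z.2) ∪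
          s.biUnion (Sum.elim (fun _ => ∅) (Sum.elim (fun _ => ∅) fun z =>
            Finset.univ.image z.2.1.1.1 ∪ Finset.univ.image z.2.1.1.2))
        have huQ : ∀ t e, u t e ∈ Q := fun t e =>
          Finset.mem_union_left _ (Finset.mem_image.2 ⟨(t, e), Finset.mem_univ _, rfl⟩)
        obtain ⟨N, hN, b, hb, a, hap, w, hw, hwφ⟩ := h (Q.card + 1)
        -- The finitely many rationals in play are sent to their ranks in `Q`. The given changes
        -- occur along `w` instead of `g ∘ u`, so `a` is then moved by indiscernibility.
        let g : ℚ → Fin N := fun x => ⟨(Q.filter (· < x)).card,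
          (Finset.card_filter_le _ _).trans_lt hN⟩
        have hg : ∀ x ∈ Q, ∀ y, x < y → g x < g y := fun x hx y hxy => by
          refine Fin.lt_def.2 (Finset.card_lt_card ((Finset.ssubset_iff_of_subset
            fun z hz => ?_).2 ⟨x, by simp [hx, hxy], by simp⟩))
          rw [Finset.mem_filter] at hz ⊢
          exact ⟨hz.1, hz.2.trans hxy⟩
        have hgu : IsPairSeq fun t e => g (u t e) :=
          ⟨fun i => hg _ (huQ i 0) _ (hu.1 i), fun i j hij => hg _ (huQ i 1) _ (hu.2 i j hij)⟩
        obtain ⟨a', ha'⟩ := hb.exists_realize_iff hM hw.strictMono_flatten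
          hgu.strictMono_flatten a
        have hφ : ∀ t e, φ.Realize (Sum.elim a' (b (g (u t e)))) ↔
            φ.Realize (Sum.elim a (b (w t e))) := by
          intro t e
          have := ha' (φ.relabel (Sum.map id (Prod.mk (finProdFinEquiv (t, e)))))
          simp only [Formula.realize_relabel] at this
          convert this using 2 <;> funext z <;> rcases z with z | z <;> simp
        refine ⟨Sum.elim a' fun z => b (g z.1) z.2, fun i hi => ?_⟩
        rcases i with ψ | t | ⟨j, z, ψ⟩
        · simp only [χ, Sum.elim_inl, Formula.realize_relabel]
          have := ha' (ψ.1.relabel Sum.inl)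
          simp only [Formula.realize_relabel, Sum.elim_comp_inl] at this
          exact this.2 (hap _ ψ.2)
        · simp only [χ, Sum.elim_inr, Sum.elim_inl, Formula.realize_not, Formula.realize_iff, hat]
          exact fun hc => hwφ t ((hφ t 0).symm.trans (hc.trans (hφ t 1)))
        · have hQ : ∀ y, z.1.1 y ∈ Q ∧ z.1.2 y ∈ Q := fun y => by
            constructor <;> refine Finset.mem_union_right _ (Finset.mem_biUnion.2 ⟨_, hi, ?_⟩) <;>
              simp
          simp only [χ, Sum.elim_inr, Formula.realize_iff, Formula.realize_relabel]
          exact hb j (fun y => g (z.1.1 y)) (fun y => g (z.1.2 y))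
            (fun x y hxy => hg _ (hQ x).1 _ (z.2.1 hxy))
            (fun x y hxy => hg _ (hQ x).2 _ (z.2.2 hxy)) ψ)
    refine ⟨v, fun i => ?_⟩
    have := hv i
    rwa [Formula.realize_relabel, Sum.elim_comp_inl] at this
  refine ⟨fun x y => v (Sum.inr (x, y)), fun j s t hs ht ψ => ?_, v ∘ Sum.inl, fun ψ hψ => ?_,
    u, hu, fun t => ?_⟩
  · have := hv (Sum.inr (Sum.inr ⟨j, ⟨(s, t), hs, ht⟩, ψ⟩))
    simp only [χ, Sum.elim_inr, Formula.realize_iff, Formula.realize_relabel] at this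
    exact this
  · have := hv (Sum.inl ⟨ψ, hψ⟩)
    simp only [χ, Sum.elim_inl, Formula.realize_relabel] at this
    exact this
  · have := hv (Sum.inr (Sum.inl t))
    simp only [χ, Sum.elim_inr, Sum.elim_inl, Formula.realize_not, Formula.realize_iff, hat] at this
    exact this

theorem IsOmegaSaturated.vcIndDensityLE_of_dpRankLE (hM : IsOmegaSaturated L M) {k n m : ℕ}
    {p : Set (L.Formula (Fin k))} (hp : DPRankLE L M p n) (φ : L.Formula (Fin k ⊕ Fin m)) :
    VCIndDensityLE L M p φ n := by
  have hN : ∃ N₀ : ℕ, ∀ N ≥ N₀, ∀ b : Fin N → Fin m → M, Indiscernible L b →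
      ∀ w ∈ patterns p φ b, ∀ u : Fin (n + 1) → Fin 2 → Fin N, IsPairSeq u →
        ∃ t, w (u t 0) ↔ w (u t 1) := by
    by_contra! hcon
    obtain ⟨b, hb, a, ha, u, hu, hφ⟩ := hM.exists_indiscernible_rat (r := n + 1) p φ (by
      intro N₀
      obtain ⟨N, hN, b, hb, w, ⟨a, hap, ha⟩, u, hu, hw⟩ := hcon N₀
      refine ⟨N, hN, b, hb, a, hap, u, hu, fun t ht => ?_⟩
      rw [← ha, ← ha] at ht
      rcases hw t with h | h
      · exact h.2 (ht.1 h.1)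
      · exact h.1 (ht.2 h.2))
    obtain ⟨C, hC, hCe⟩ := hp a ha m b hb
    obtain ⟨t, ht⟩ := hu.exists_cutEquiv hC
    exact hφ t (Set.ext_iff.1 (hCe _ _ ht) φ)
  obtain ⟨N₀, hN₀⟩ := hN
  -- The first summand serves `N ≥ N₀`; the second is the trivial bound for shorter sequences.
  refine ⟨((2 ^ (2 * n + 1) + 2 ^ N₀ : ℕ) : ℝ), fun N hN b hb => ⟨hM.finite_phiTypes p φ b, ?_⟩⟩
  rw [hM.ncard_phiTypes, Real.rpow_natCast]
  suffices (patterns p φ b).ncard ≤ (2 ^ (2 * n + 1) + 2 ^ N₀) * N ^ n by exact_mod_cast this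
  rcases le_total N₀ N with h | h
  · exact (ncard_le_of_forall_not_isPairSeq hN _ (hN₀ N h b hb)).trans
      (Nat.mul_le_mul_right _ (Nat.le_add_right _ _))
  · calc (patterns p φ b).ncard ≤ (Set.univ : Set (Fin N → Prop)).ncard :=
          Set.ncard_le_ncard (Set.subset_univ _)
      _ = 2 ^ N := by simp [Set.ncard_univ]
      _ ≤ 2 ^ N₀ := Nat.pow_le_pow_right two_pos h
      _ ≤ (2 ^ (2 * n + 1) + 2 ^ N₀) * N ^ n :=
          (Nat.le_add_left _ _).trans (Nat.le_mul_of_pos_right _ (by positivity))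

/-- The sequence of the concatenated pairs of members of `b`. -/
def pairTuple {I : Type*} {m N : ℕ} (b : I → Fin m → M) (u : Fin N → Fin 2 → I) (i : Fin N)
    (y : Fin (2 * m)) : M :=
  b (u i (finProdFinEquiv.symm y).1) (finProdFinEquiv.symm y).2

/-- A formula about `r` increasing pairs is a formula about `2r` increasing members of `b`. -/
theorem Indiscernible.pairTuple {I : Type*} [LinearOrder I] {m N : ℕ} {b : I → Fin m → M}
    (hb : Indiscernible L b) {u : Fin N → Fin 2 → I} (hu : IsPairSeq u) :
    Indiscernible L (pairTuple b u) := by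
  intro r s t hs ht ψ
  let f : Fin r × Fin (2 * m) → Fin (r * 2) × Fin m := fun z =>
    (finProdFinEquiv (z.1, (finProdFinEquiv.symm z.2).1), (finProdFinEquiv.symm z.2).2)
  have hcomp : ∀ s : Fin r → Fin N, StrictMono s → IsPairSeq fun i => u (s i) := fun s hs =>
    ⟨fun i => hu.1 _, fun i j hij => hu.2 _ _ (hs hij)⟩
  have := hb (r * 2) _ _ (hcomp s hs).strictMono_flatten (hcomp t ht).strictMono_flatten
    (ψ.relabel f)
  simp only [Formula.realize_relabel, Function.comp_def, f, flatten_finProdFinEquiv] at this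
  exact this

/-- The formula saying that one of the formulas `ψ t` distinguishes the two halves of a tuple. -/
theorem exists_formula_pairTuple {k m n : ℕ} (ψ : Fin n → L.Formula (Fin k ⊕ Fin m)) :
    ∃ φ : L.Formula (Fin k ⊕ Fin (2 * m)), ∀ (a : Fin k → M) (y : Fin (2 * m) → M),
      φ.Realize (Sum.elim a y) ↔
        (fun t => (ψ t).Realize (Sum.elim a fun j => y (finProdFinEquiv (0, j)))) ≠
          fun t => (ψ t).Realize (Sum.elim a fun j => y (finProdFinEquiv (1, j))) := by
  let half : Fin 2 → Fin n → L.Formula (Fin k ⊕ Fin (2 * m)) := fun e t =>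
    (ψ t).relabel (Sum.map id fun j => finProdFinEquiv (e, j))
  have hhalf : ∀ e t (a : Fin k → M) (y : Fin (2 * m) → M), (half e t).Realize (Sum.elim a y) ↔
      (ψ t).Realize (Sum.elim a fun j => y (finProdFinEquiv (e, j))) := by
    intro e t a y
    rw [Formula.realize_relabel]
    refine iff_of_eq (congrArg _ (funext ?_))
    rintro (i | i) <;> rfl
  refine ⟨(Formula.iInf fun t => (half 0 t).iff (half 1 t)).not, fun a y => ?_⟩
  rw [Formula.realize_not, Formula.realize_iInf, Ne, funext_iff]
  simp only [Formula.realize_iff, hhalf, eq_iff_iff]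

theorem IsOmegaSaturated.dpRankLE_of_vcIndDensityLE (hM : IsOmegaSaturated L M) {k n : ℕ}
    {p : Set (L.Formula (Fin k))}
    (hp : ∀ (m : ℕ) (φ : L.Formula (Fin k ⊕ Fin m)), VCIndDensityLE L M p φ n) :
    DPRankLE L M p n := by
  intro a ha m b hb
  by_contra! hcon
  obtain ⟨v, hv, hne⟩ := exists_isPairSeq_of_lt_encard (fun i => tpOver L a (b i)) _
    (fun c hc => hc) n (lt_of_not_ge fun hle => by
      obtain ⟨i, j, hij, hne⟩ := hcon _ hle
      exact hne (eq_of_cutEquiv_of_locally_constant _ i j hij))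
  have hψ : ∀ t, ∃ ψ : L.Formula (Fin k ⊕ Fin m),
      ¬ (ψ.Realize (Sum.elim a (b (v t 0))) ↔ ψ.Realize (Sum.elim a (b (v t 1)))) := by
    intro t
    by_contra! h
    exact hne t (Set.ext h)
  choose ψ hψ using hψ
  obtain ⟨φ, hφ⟩ := exists_formula_pairTuple (M := M) ψ
  -- Full types may give infinitely many colours; keeping only the `n + 1` witnesses makes the
  -- colouring finite.
  let f : ℚ → Fin (n + 1) → Prop := fun i t => (ψ t).Realize (Sum.elim a (b i))
  have hf : ∀ t, f (v t 0) ≠ f (v t 1) := fun t h => hψ t (iff_of_eq (congrFun h t))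
  have hφf : ∀ {N : ℕ} (u : Fin N → Fin 2 → ℚ) i,
      φ.Realize (Sum.elim a (pairTuple b u i)) ↔ f (u i 0) ≠ f (u i 1) := by
    intro N u i
    rw [hφ]
    simp only [pairTuple, Equiv.symm_apply_apply, f]
  obtain ⟨K, hK⟩ := hp _ φ
  obtain ⟨N, hN, hlt⟩ := exists_lt_choose n K
  let u₀ : Fin N → Fin 2 → ℚ := fun i e => ((2 * i + e : ℕ) : ℚ)
  have hu₀ : IsPairSeq u₀ := by
    refine ⟨fun i => ?_, fun i j hij => ?_⟩
    · simp [u₀]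
    · have : (i : ℕ) < j := hij
      simp only [u₀, Nat.cast_lt]
      simp only [Fin.val_zero, Fin.val_one]
      omega
  obtain ⟨-, hle⟩ := hK N hN _ (hb.pairTuple hu₀)
  rw [hM.ncard_phiTypes, Real.rpow_natCast] at hle
  have hmem : ∀ S : Finset (Fin N), S.card = n + 1 →
      (fun i => i ∈ S) ∈ patterns p φ (pairTuple b u₀) := by
    intro S hS
    obtain ⟨u, hu, huS⟩ := exists_isPairSeq_ne_iff_mem f hv hf S hS
    -- The pairs `u` depend on `S`. Moving `a` to `a'` instead puts all the patterns on the single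
    -- sequence given by `u₀`.
    obtain ⟨a', ha'⟩ := hb.exists_realize_iff hM hu.strictMono_flatten hu₀.strictMono_flatten a
    refine ⟨a', fun θ hθ => ?_, fun i => ?_⟩
    · have := ha' (θ.relabel Sum.inl)
      simp only [Formula.realize_relabel, Sum.elim_comp_inl] at this
      exact this.2 (ha θ hθ)
    · have := ha' (φ.relabel (Sum.map id fun y =>
        (finProdFinEquiv (i, (finProdFinEquiv.symm y).1), (finProdFinEquiv.symm y).2)))
      simp only [Formula.realize_relabel, Sum.elim_comp_map, Function.comp_id] at this
      refine (huS i).symm.trans ((hφf u i).symm.trans ?_)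
      convert this.symm using 3 <;> funext y <;> simp [pairTuple]
  have hchoose : N.choose (n + 1) ≤ (patterns p φ (pairTuple b u₀)).ncard := by
    have hinj : Function.Injective fun (S : Finset (Fin N)) (i : Fin N) => i ∈ S :=
      fun S S' h => Finset.ext fun i => iff_of_eq (congrFun h i)
    calc N.choose (n + 1) = (Finset.powersetCard (n + 1) (Finset.univ : Finset (Fin N))).card := by
          simp
      _ = ((fun (S : Finset (Fin N)) (i : Fin N) => i ∈ S) ''
            (Finset.powersetCard (n + 1) (Finset.univ : Finset (Fin N)))).ncard := by
          rw [Set.ncard_image_of_injective _ hinj, Set.ncard_coe_finset]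
      _ ≤ _ := Set.ncard_le_ncard (by
          rintro _ ⟨S, hS, rfl⟩
          exact hmem S (Finset.mem_powersetCard.1 hS).2)
  have : (N.choose (n + 1) : ℝ) ≤ (patterns p φ (pairTuple b u₀)).ncard := by exact_mod_cast hchoose
  linarith

end Main

end VCInd

/-- Parameters of the partial type `p(x)` come from the small set `A`; formulas, types and
indiscernibility are those of the language `L[[A]]`, that is, over `A`. -/
theorem mainTheorem3 (L : FirstOrder.Language.{u, v}) (T : L.Theory) (hT : T.IsComplete)
    (M : Type w) [L.Structure M] [M ⊨ T]
    (κ : Cardinal.{w}) (hκ : ℵ₀ ≤ κ) (hM : VCInd.IsSaturated L M κ)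
    (A : Set M) (hA : #A < κ)
    (k : ℕ) (p : Set (L[[A]].Formula (Fin k))) (n : ℕ) :
    VCInd.DPRankLE (L[[A]]) M p n ↔
      ∀ (m : ℕ) (φ : L[[A]].Formula (Fin k ⊕ Fin m)),
        VCInd.VCIndDensityLE (L[[A]]) M p φ (n : ℝ) := by
  have hω := hM.isOmegaSaturated hκ A hA
  exact ⟨fun h _ φ => hω.vcIndDensityLE_of_dpRankLE h φ, hω.dpRankLE_of_vcIndDensityLE⟩
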